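/- Let $d\ge 0$ and let $(\Omega,P)$ be a probability space on which $\mathbb{Z}^d$ acts by measurable, $P$-preserving maps $\{\tau_z\}_{z\in\mathbb{Z}^d}$; assume that the action is ergodic. Let $\Lambda=\{d_1,\dots,d_N\}\subset\mathbb{Z}^d$ be finite (the $d_i$ distinct, in any order). For every $\omega\in\Omega$ let $p(\omega)=(p_{xy}(\omega))_{x,y\in\mathbb{Z}^d}$ be a non-negative matrix, measurable in $\omega$, such that for all $\omega$, $x$, $y$, $z$: * $\sum_{y'}p_{xy'}(\omega)=1$ and $\sum_{x'}p_{x'y}(\omega)=1$ (bistochasticity); * $p_{xy}(\omega)=0$ if $y-x\notin\Lambda$ (finite range); * $\sum_{y'}(y'-x)\,p_{xy'}(\omega)=0$ (zero local drift); * $p_{xy}(\tau_z\omega)=p_{x+z,\,y+z}(\omega)$. Assume that $p$ is almost surely irreducible: for $P$-a.e. $\omega$ and every $y\in\mathbb{Z}^d$ there is $n\ge1$ such that the $n$-step transition probability $p^{(n)}_{0y}(\omega)$ is positive. Point-of-view-of-the-particle system. Let $I=[0,1)$ with Lebesgue measure $m$, and $\mu=m\times P$ on $I\times\Omega$. Put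 $q_i(\omega)=p_{0d_i}(\omega)$, $a_0=0$, $a_i=a_{i-1}+q_i$, $I_i=[a_{i-1},a_i)$. These intervals partition $I$; let $i(s,\omega)$ be the unique $i$ with $s\in I_i(\omega)$. Define $$D(s,\omega)=d_{i(s,\omega)},\qquad \phi(s,\omega)=\frac{s-a_{i(s,\omega)-1}(\omega)}{q_{i(s,\omega)}(\omega)},\qquad T(s,\omega)=\bigl(\phi(s,\omega),\tau_{D(s,\omega)}\omega\bigr),$$ and $X_n=\sum_{k=0}^{n-1}D\circ T^k$. Annealed walk. For $\omega\in\Omega$ let $P_\omega$ be the law on $(\mathbb{Z}^d)^{\mathbb{N}}$ of the Markov chain started at $0$ with transition probabilities $p(\omega)$, and let $\mathbb{P}$ be the annealed law on $\Omega\times(\mathbb{Z}^d)^{\mathbb{N}}$, given by $\mathbb{P}(B\times E)=\int_B P_\omega(E)\,P(d\omega)$. **Theorem (annealed Central Limit Theorem).** The functions $D^{(\alpha)}D^{(\beta)}$ are $\mu$-integrable, the matrix $C=(c_{\alpha\beta})_{\alpha,\beta=1}^d$ with $$c_{\alpha\beta}=\int_{I\times\Omega}D^{(\alpha)}D^{(\beta)}\,d\mu$$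 is positive semidefinite, and $X_n/\sqrt n$ converges in distribution under $\mu$, as $n\to\infty$, to the (possibly degenerate) centered Gaussian law $N(0,C)$ on $\mathbb{R}^d$. Likewise, the $n$-th position of the walk, divided by $\sqrt n$, converges in distribution to $N(0,C)$ under the annealed law $\mathbb{P}$. -/

import Mathlib

open MeasureTheory ProbabilityTheory Filter Topology

noncomputable section

namespace BistochasticRWRE

/-- The lattice `ℤ^d`. -/
abbrev Zd (d : ℕ) : Type := Fin d → ℤ

/-- The inclusion `ℤ^d ⊂ ℝ^d`. -/
def toEuclid {d : ℕ} (x : Zd d) : EuclideanSpace ℝ (Fin d) :=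
  WithLp.toLp 2 (fun α => (x α : ℝ))

/-- A bistochastic, finite-range environment on `ℤ^d` with zero local drift. The group `ℤ^d` acts
on `Ω` (the action `τ_z ω` is written `z +ᵥ ω`), and `p ω x y` is the probability to jump from `x`
to `y` in the environment `ω`. -/
structure Environment (d : ℕ) (Ω : Type*) [MeasurableSpace Ω] [AddAction (Zd d) Ω] where
  /-- the transition probabilities -/
  p : Ω → Zd d → Zd d → ℝ
  /-- the finite set of allowed jumps -/
  Λ : Finset (Zd d)
  measurable_p : ∀ x y, Measurable fun ω => p ω x y
  nonneg : ∀ ω x y, 0 ≤ p ω x y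
  /-- normalization -/
  hasSum_row : ∀ ω x, HasSum (fun y => p ω x y) 1
  /-- bistochasticity -/
  hasSum_col : ∀ ω y, HasSum (fun x => p ω x y) 1
  /-- finite range -/
  finite_range : ∀ ω x y, y - x ∉ Λ → p ω x y = 0
  /-- zero local drift -/
  zero_drift : ∀ ω x, HasSum (fun y => p ω x y • toEuclid (y - x)) 0
  /-- the group acts by translating the environment -/
  equivariant : ∀ ω z x y, p (z +ᵥ ω) x y = p ω (x + z) (y + z)

/-- The unit interval `I = [0,1)`. -/
abbrev UnitIco : Type := Set.Ico (0 : ℝ) 1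

/-- Lebesgue measure on `I = [0,1)`. -/
def lebesgueI : Measure UnitIco := Measure.comap Subtype.val (volume : Measure ℝ)

instance : IsProbabilityMeasure lebesgueI := ⟨by
  rw [lebesgueI, (MeasurableEmbedding.subtype_coe measurableSet_Ico).comap_apply,
    Set.image_univ, Subtype.range_coe_subtype]
  change volume (Set.Ico (0 : ℝ) 1) = 1
  simp⟩

namespace Environment

variable {d : ℕ} {Ω : Type*} [MeasurableSpace Ω] [AddAction (Zd d) Ω] (env : Environment d Ω)

/-- The `n`-step transition probabilities `p^{(n)}_{xy}`. -/
def nStep (ω : Ω) : ℕ → Zd d → Zd d → ℝ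
  | 0 => fun x y => if x = y then 1 else 0
  | n + 1 => fun x y => ∑' z, env.p ω x z * nStep ω n z y

/-- Almost sure irreducibility: for a.e. environment, every site can be reached from `0`. -/
def AlmostSurelyIrreducible (P : Measure Ω) : Prop :=
  ∀ᵐ ω ∂P, ∀ y : Zd d, ∃ n : ℕ, 1 ≤ n ∧ 0 < env.nStep ω n 0 y

/-! ### The walk and its annealed law -/

/-- The law `p_{x·}(ω)` of one jump of the walk from `x`. -/
def stepPMF (ω : Ω) (x : Zd d) : PMF (Zd d) :=
  ⟨fun y => ENNReal.ofReal (env.p ω x y), by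
    have h := env.hasSum_row ω x
    have h2 := ENNReal.ofReal_tsum_of_nonneg (env.nonneg ω x) h.summable
    rw [h.tsum_eq, ENNReal.ofReal_one] at h2
    rw [h2]
    exact ENNReal.summable.hasSum⟩

/-- The transition kernel on `ℤ^d` of the Markov chain in the environment `ω`. -/
def stepKernel (ω : Ω) : Kernel (Zd d) (Zd d) :=
  Kernel.ofFunOfCountable fun x => (env.stepPMF ω x).toMeasure

instance (ω : Ω) : IsMarkovKernel (env.stepKernel ω) :=
  ⟨fun x => by
    change IsProbabilityMeasure (env.stepPMF ω x).toMeasure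
    infer_instance⟩

/-- The law `P_ω` on `(ℤ^d)^ℕ` of the Markov chain started at `0` with transition probabilities
`p(ω)`. -/
def quenched (ω : Ω) : Measure (ℕ → Zd d) :=
  Kernel.trajMeasure (X := fun _ => Zd d) (Measure.dirac 0)
    (fun n => (env.stepKernel ω).comap (fun h => h ⟨n, by simp⟩) (by fun_prop))

instance (ω : Ω) : IsProbabilityMeasure (env.quenched ω) := by
  unfold quenched; infer_instance

theorem quenched_map_zero (ω ω' : Ω) :
    (env.quenched ω).map (Preorder.frestrictLe 0) =
      (env.quenched ω').map (Preorder.frestrictLe (π := fun _ => Zd d) 0) := by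
  simp only [quenched, Kernel.trajMeasure]
  rw [Measure.map_comp _ _ (by fun_prop), Measure.map_comp _ _ (by fun_prop),
    Kernel.traj_map_frestrictLe, Kernel.traj_map_frestrictLe, Kernel.partialTraj_self,
    Kernel.partialTraj_self]

theorem measurable_quenched_map (n : ℕ) : Measurable fun ω =>
    (env.quenched ω).map (Preorder.frestrictLe (π := fun _ => Zd d) n) := by
  induction n with
  | zero =>
    rcases isEmpty_or_nonempty Ω with h | ⟨⟨ω₀⟩⟩
    · exact measurable_of_empty _
    · simp_rw [fun ω => env.quenched_map_zero ω ω₀]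
      exact measurable_const
  | succ n ih =>
    have key : Measurable fun ω => (env.quenched ω).map
        (fun x : ℕ → Zd d => (Preorder.frestrictLe (π := fun _ => Zd d) n x, x (n + 1))) := by
      simp only [quenched] at ih ⊢
      simp_rw [← Kernel.map_frestrictLe_trajMeasure_compProd_eq_map_trajMeasure]
      refine Measure.measurable_of_measurable_coe _ fun s hs => ?_
      simp_rw [Measure.compProd_apply hs, lintegral_countable']
      refine Measurable.tsum fun h => Measurable.mul ?_
        (Measure.measurable_coe (measurableSet_singleton h) |>.comp ih)
      simp only [Kernel.comap_apply, stepKernel]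
      change Measurable fun ω => (env.stepPMF ω _).toMeasure _
      simp_rw [PMF.toMeasure_apply _ (measurable_prodMk_left hs)]
      refine Measurable.tsum fun y => ?_
      by_cases hy : y ∈ Prod.mk h ⁻¹' s
      · simp only [Set.indicator_of_mem hy]
        exact (env.measurable_p _ _).ennreal_ofReal
      · simp only [Set.indicator_of_notMem hy]
        exact measurable_const
    let g : (Finset.Iic n → Zd d) × Zd d → (Finset.Iic (n + 1) → Zd d) :=
      fun x i => if h : i.val ≤ n then x.1 ⟨i.val, Finset.mem_Iic.2 h⟩ else x.2
    have hg : Measurable g := .of_discrete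
    have h2 : ∀ ω, (env.quenched ω).map (Preorder.frestrictLe (π := fun _ => Zd d) (n + 1)) =
        ((env.quenched ω).map (fun x : ℕ → Zd d =>
          (Preorder.frestrictLe (π := fun _ => Zd d) n x, x (n + 1)))).map g := by
      intro ω
      rw [Measure.map_map hg (by fun_prop)]
      congr 1
      funext x i
      by_cases h : i.val ≤ n
      · simp [g, h]
      · have hi : i.val = n + 1 := le_antisymm (Finset.mem_Iic.1 i.2) (by omega)
        simp [g, hi]
    simp_rw [h2]
    exact (Measure.measurable_map g hg).comp key

theorem measurable_quenched : Measurable env.quenched := by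
  refine Measurable.measure_of_isPiSystem_of_isProbabilityMeasure
    (generateFrom_measurableCylinders (α := fun _ : ℕ => Zd d)).symm
    isPiSystem_measurableCylinders fun t ht => ?_
  obtain ⟨s, S, hS, rfl⟩ := (mem_measurableCylinders t).1 ht
  have hs : s ⊆ Finset.Iic (s.sup id) := fun i hi => Finset.mem_Iic.2 (Finset.le_sup (f := id) hi)
  have h2 : MeasurableSet (Finset.restrict₂ (π := fun _ : ℕ => Zd d) hs ⁻¹' S) := .of_discrete
  convert (Measure.measurable_coe h2).comp (env.measurable_quenched_map (s.sup id)) using 1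
  funext ω
  exact (Measure.map_apply
    (Preorder.measurable_frestrictLe (X := fun _ : ℕ => Zd d) (s.sup id)) h2).symm

/-- `ω ↦ P_ω` as a kernel. -/
def quenchedKernel : Kernel Ω (ℕ → Zd d) := ⟨env.quenched, env.measurable_quenched⟩

instance : IsMarkovKernel env.quenchedKernel :=
  ⟨fun ω => by change IsProbabilityMeasure (env.quenched ω); infer_instance⟩

/-- The annealed law on `Ω × (ℤ^d)^ℕ`, i.e. `ℙ(B × E) = ∫_B P_ω(E) P(dω)`. -/
def annealed (P : Measure Ω) : Measure (Ω × (ℕ → Zd d)) := P ⊗ₘ env.quenchedKernel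

instance (P : Measure Ω) [IsProbabilityMeasure P] : IsProbabilityMeasure (env.annealed P) := by
  unfold annealed; infer_instance

theorem annealed_prod (P : Measure Ω) [IsProbabilityMeasure P] {B : Set Ω} {E : Set (ℕ → Zd d)}
    (hB : MeasurableSet B) (hE : MeasurableSet E) :
    env.annealed P (B ×ˢ E) = ∫⁻ ω in B, env.quenched ω E ∂P :=
  Measure.compProd_apply_prod hB hE

/-! ### The point-of-view-of-the-particle dynamical system

Below `e` is an enumeration `d_0, …, d_{N-1}` of `Λ`. -/

variable (e : Fin env.Λ.card ≃ env.Λ)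

/-- `q_i(ω) = p_{0 d_i}(ω)`. -/
def q (ω : Ω) (i : Fin env.Λ.card) : ℝ := env.p ω 0 (e i)

/-- The partial sums `a_k = ∑_{j < k} q_j` (there are `k` summands). -/
def cut (ω : Ω) (k : ℕ) : ℝ := ∑ j with j.val < k, env.q e ω j

/-- The interval `I_i(ω)` between two consecutive partial sums; its length is `q_i(ω)`. -/
def interval (ω : Ω) (i : Fin env.Λ.card) : Set ℝ :=
  Set.Ico (env.cut e ω i.val) (env.cut e ω (i.val + 1))

theorem cut_zero (ω : Ω) : env.cut e ω 0 = 0 := by simp [cut]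

theorem cut_succ (ω : Ω) (i : Fin env.Λ.card) :
    env.cut e ω (i.val + 1) = env.cut e ω i.val + env.q e ω i := by
  have h : (Finset.univ.filter fun j : Fin env.Λ.card => j.val < i.val + 1) =
      insert i (Finset.univ.filter fun j : Fin env.Λ.card => j.val < i.val) := by
    ext j
    simp only [Finset.mem_filter, Finset.mem_univ, true_and, Finset.mem_insert, Fin.ext_iff]
    omega
  rw [cut, h, Finset.sum_insert (by simp), cut, add_comm]

theorem cut_mono (ω : Ω) : Monotone (env.cut e ω) := fun k l hkl =>
  Finset.sum_le_sum_of_subset_of_nonneg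
    (fun j hj => by
      simp only [Finset.mem_filter, Finset.mem_univ, true_and] at hj ⊢
      omega)
    (fun _ _ _ => env.nonneg _ _ _)

theorem sum_q (ω : Ω) : ∑ i, env.q e ω i = 1 := by
  have h1 : HasSum (fun y => env.p ω 0 y) (∑ y ∈ env.Λ, env.p ω 0 y) :=
    hasSum_sum_of_ne_finset_zero fun y hy => env.finite_range ω 0 y (by simpa using hy)
  rw [← h1.unique (env.hasSum_row ω 0), ← Finset.sum_coe_sort env.Λ]
  exact Equiv.sum_comp e (fun y : env.Λ => env.p ω 0 y)

theorem cut_card (ω : Ω) : env.cut e ω env.Λ.card = 1 := by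
  simp [cut, sum_q]

theorem existsUnique_index (ω : Ω) (s : UnitIco) :
    ∃! i : Fin env.Λ.card, s.val ∈ env.interval e ω i := by
  have hex : ∃ k, s.val < env.cut e ω k := ⟨env.Λ.card, by rw [cut_card]; exact s.2.2⟩
  classical
  obtain ⟨k, hk, hmin⟩ : ∃ k, s.val < env.cut e ω k ∧ ∀ m < k, env.cut e ω m ≤ s.val :=
    ⟨Nat.find hex, Nat.find_spec hex, fun m hm => not_lt.1 (Nat.find_min hex hm)⟩
  have hk0 : k ≠ 0 := by
    rintro rfl
    rw [cut_zero] at hk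
    exact absurd s.2.1 (not_le.2 hk)
  obtain ⟨m, rfl⟩ := Nat.exists_eq_succ_of_ne_zero hk0
  have hm : m < env.Λ.card := by
    by_contra hcon
    have h := (env.cut_mono e ω (not_lt.1 hcon)).trans (hmin m (Nat.lt_succ_self m))
    rw [cut_card] at h
    exact absurd s.2.2 (not_lt.2 h)
  refine ⟨⟨m, hm⟩, ⟨hmin m (Nat.lt_succ_self m), hk⟩, ?_⟩
  rintro j ⟨hj1, hj2⟩
  rcases lt_trichotomy j.val m with h | h | h
  · exact absurd ((env.cut_mono e ω (Nat.succ_le_of_lt h)).trans (hmin m (Nat.lt_succ_self m)))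
      (not_le.2 hj2)
  · exact Fin.ext h
  · exact absurd ((env.cut_mono e ω (Nat.succ_le_of_lt h)).trans hj1) (not_le.2 hk)

/-- `i(s,ω)`: the unique `i` with `s ∈ I_i(ω)`. -/
def index (s : UnitIco) (ω : Ω) : Fin env.Λ.card := (env.existsUnique_index e ω s).choose

theorem index_spec (s : UnitIco) (ω : Ω) : s.val ∈ env.interval e ω (env.index e s ω) :=
  (env.existsUnique_index e ω s).choose_spec.1

/-- The displacement function `D(s,ω) = d_{i(s,ω)}`. -/
def displacement (x : UnitIco × Ω) : Zd d := e (env.index e x.1 x.2)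

/-- The internal dynamics `φ(s,ω)`: on `I_i(ω)` it is the increasing affine bijection onto
`[0,1)`. -/
def phi (x : UnitIco × Ω) : UnitIco :=
  ⟨(env.q e x.2 (env.index e x.1 x.2))⁻¹ *
      (x.1.val - env.cut e x.2 (env.index e x.1 x.2).val), by
    obtain ⟨h1, h2⟩ := env.index_spec e x.1 x.2
    rw [cut_succ] at h2
    have hq : 0 < env.q e x.2 (env.index e x.1 x.2) := by linarith
    rw [inv_mul_eq_div]
    exact ⟨div_nonneg (by linarith) hq.le, (div_lt_one hq).2 (by linarith)⟩⟩

/-- The skew product `T(s,ω) = (φ(s,ω), τ_{D(s,ω)} ω)`. -/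
def povMap (x : UnitIco × Ω) : UnitIco × Ω := (env.phi e x, env.displacement e x +ᵥ x.2)

/-- The walk `X_n = ∑_{k<n} D ∘ T^k` on the point-of-view-of-the-particle system. -/
def walk (n : ℕ) (x : UnitIco × Ω) : Zd d :=
  ∑ k ∈ Finset.range n, env.displacement e ((env.povMap e)^[k] x)

end Environment

/-- The measure `μ = m × P` on `I × Ω`. -/
def povMeasure {Ω : Type*} [MeasurableSpace Ω] (P : Measure Ω) : Measure (UnitIco × Ω) :=
  lebesgueI.prod P

instance {Ω : Type*} [MeasurableSpace Ω] (P : Measure Ω) [IsProbabilityMeasure P] :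
    IsProbabilityMeasure (povMeasure P) := by
  unfold povMeasure; infer_instance

/-- The matrix `c_{αβ} = ∫ D^{(α)} D^{(β)} dμ`. -/
def Environment.covMatrix {d : ℕ} {Ω : Type*} [MeasurableSpace Ω] [AddAction (Zd d) Ω]
    (env : Environment d Ω) (e : Fin env.Λ.card ≃ env.Λ) (P : Measure Ω) :
    Matrix (Fin d) (Fin d) ℝ :=
  fun α β => ∫ x, (env.displacement e x α : ℝ) * (env.displacement e x β : ℝ) ∂(povMeasure P)

/-- The `ℤ^d`-valued process `X` satisfies the central limit theorem with mean zero and covariance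
matrix `C` (possibly degenerate): `X_n / √n` converges in distribution to `N(0, C)`. -/
def SatisfiesCLT {d : ℕ} {S : Type*} [MeasurableSpace S] (X : ℕ → S → Zd d) (μ : Measure S)
    [IsProbabilityMeasure μ] (C : Matrix (Fin d) (Fin d) ℝ) : Prop :=
  C.PosSemidef ∧
    TendstoInDistribution (fun (n : ℕ) s => (√(n : ℝ))⁻¹ • toEuclid (X n s)) atTop id
      (fun _ => μ) (multivariateGaussian 0 C)

end BistochasticRWRE

end

open BistochasticRWRE

/-!
By Lévy's theorem it suffices to follow the characteristic functions `∫ χ(X_n)` for the characters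
`χ(x) = exp (i ⟨x, t⟩ / √n)`. For both the particle system and the annealed walk this integral is
`⟨1, (R_n)^n 1⟩` in `L²(P)`, where `R_n f = ∑ y, p_{0y} χ(y) f ∘ τ_y` is the transition operator
of the environment seen from the particle, twisted by `χ`. Bistochasticity makes `R_n` a
contraction, and zero drift gives `n (R_n 1 - 1) → -b` with `b = ½ ∑ y, p_{0y} ⟨y, t⟩²`. The
function `b` need not be constant, but a vector fixed by the untwisted operator `Q` is invariant
along every possible jump, hence under all translations by irreducibility, hence constant by
ergodicity; so `b - ∫ b` lies in the closure of the range of `1 - Q`. Correcting `1` by `g / n`,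
where `g - Q g` approximates `b - ∫ b`, produces approximate eigenvectors of `R_n` with eigenvalue
`exp (-(∫ b) / n)`, whence `(R_n)^n 1 → exp (-∫ b)`.
-/

namespace BistochasticRWRE

/-! ### Powers of contractions -/

theorem tendsto_mul_exp_sub_sum {ι : Type*} {l : Filter ι} {r a : ι → ℂ} {k : ℕ} {s : ℂ}
    (ha : Tendsto a l (𝓝 0)) (hra : Tendsto (fun i => r i * a i ^ k) l (𝓝 s)) :
    Tendsto (fun i => r i * (Complex.exp (a i) - ∑ j ∈ Finset.range k, a i ^ j / j.factorial)) l
      (𝓝 (s / k.factorial)) := by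
  have hremainder : Tendsto (fun i => r i *
      (Complex.exp (a i) - ∑ j ∈ Finset.range (k + 1), a i ^ j / j.factorial)) l (𝓝 0) :=
    (Asymptotics.isLittleO_one_iff ℂ).1 (((Asymptotics.isBigO_refl r l).mul_isLittleO
      ((Complex.exp_sub_sum_range_succ_isLittleO_pow k).comp_tendsto ha)).trans_isBigO
      (hra.isBigO_one ℂ))
  have hsum := hremainder.add (hra.div_const (k.factorial : ℂ))
  rw [zero_add] at hsum
  refine hsum.congr fun i => ?_
  rw [Finset.sum_range_succ]
  ring

theorem tendsto_nat_mul_exp_neg_div_sub_one (c : ℂ) :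
    Tendsto (fun n : ℕ => (n : ℂ) * (Complex.exp (-c / n) - 1)) atTop (𝓝 (-c)) := by
  have hlim := tendsto_mul_exp_sub_sum (k := 1) (tendsto_const_div_atTop_nhds_zero_nat (-c))
    (tendsto_const_nhds.congr' ?_ : Tendsto (fun n : ℕ => (n : ℂ) * (-c / n) ^ 1) _ (𝓝 (-c)))
  · simpa using hlim
  · filter_upwards [eventually_ne_atTop 0] with n hn
    rw [pow_one, mul_div_cancel₀ _ (Nat.cast_ne_zero.2 hn)]

theorem tendsto_div_sqrt_nat (z : ℂ) : Tendsto (fun n : ℕ => z / √(n : ℝ)) atTop (𝓝 0) := by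
  rw [tendsto_zero_iff_norm_tendsto_zero]
  simpa [abs_of_nonneg, Real.sqrt_nonneg] using
    (Real.tendsto_sqrt_atTop.comp tendsto_natCast_atTop_atTop).const_div_atTop ‖z‖

theorem tendsto_nat_mul_exp_div_sqrt_sub_one_sub (z : ℂ) :
    Tendsto (fun n : ℕ => (n : ℂ) * (Complex.exp (z / √(n : ℝ)) - 1 - z / √(n : ℝ))) atTop
      (𝓝 (z ^ 2 / 2)) := by
  have hlim := tendsto_mul_exp_sub_sum (k := 2) (tendsto_div_sqrt_nat z)
    (tendsto_const_nhds.congr' ?_ :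
      Tendsto (fun n : ℕ => (n : ℂ) * (z / √(n : ℝ)) ^ 2) _ (𝓝 (z ^ 2)))
  · simpa [Finset.sum_range_succ, sub_sub] using hlim
  · filter_upwards [eventually_ne_atTop 0] with n hn
    rw [div_pow, ← Complex.ofReal_pow, Real.sq_sqrt n.cast_nonneg, Complex.ofReal_natCast,
      mul_div_cancel₀ _ (Nat.cast_ne_zero.2 hn)]

section Contraction

variable {E : Type*} [NormedAddCommGroup E]

theorem norm_pow_apply_le {𝕜 : Type*} [NontriviallyNormedField 𝕜] [NormedSpace 𝕜 E]
    {R : E →L[𝕜] E} (hR : ‖R‖ ≤ 1) (n : ℕ) (f : E) : ‖(R ^ n) f‖ ≤ ‖f‖ := by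
  induction n with
  | zero => simp
  | succ n ih =>
    rw [pow_succ', mul_apply_eq_comp]
    exact (R.le_of_opNorm_le hR _).trans (by rwa [one_mul])

theorem norm_pow_apply_sub_pow_smul_le {𝕜 : Type*} [NontriviallyNormedField 𝕜] [NormedSpace 𝕜 E]
    {R : E →L[𝕜] E} (hR : ‖R‖ ≤ 1) {l : 𝕜} (hl : ‖l‖ ≤ 1) (n : ℕ) (f : E) :
    ‖(R ^ n) f - l ^ n • f‖ ≤ n * ‖R f - l • f‖ := by
  induction n with
  | zero => simp
  | succ n ih =>
    have telescope : (R ^ (n + 1)) f - l ^ (n + 1) • f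
        = (R ^ n) (R f - l • f) + l • ((R ^ n) f - l ^ n • f) := by
      rw [pow_succ, mul_apply_eq_comp, map_sub, map_smul, smul_sub, smul_smul, ← pow_succ']
      abel
    calc ‖(R ^ (n + 1)) f - l ^ (n + 1) • f‖
        ≤ ‖R f - l • f‖ + 1 * ‖(R ^ n) f - l ^ n • f‖ := by
          rw [telescope]
          refine (norm_add_le _ _).trans (add_le_add (norm_pow_apply_le hR n _) ?_)
          rw [norm_smul]
          gcongr
      _ ≤ ‖R f - l • f‖ + 1 * (n * ‖R f - l • f‖) := by gcongr
      _ = (n + 1 : ℕ) * ‖R f - l • f‖ := by push_cast; ring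

theorem norm_pow_apply_sub_pow_smul_le_add {𝕜 : Type*} [NontriviallyNormedField 𝕜]
    [NormedSpace 𝕜 E] {R : E →L[𝕜] E} (hR : ‖R‖ ≤ 1) {l : 𝕜} (hl : ‖l‖ ≤ 1) (n : ℕ) (u f : E) :
    ‖(R ^ n) u - l ^ n • u‖ ≤ n * ‖R f - l • f‖ + 2 * ‖u - f‖ := by
  have hsplit : (R ^ n) u - l ^ n • u
      = ((R ^ n) f - l ^ n • f) + ((R ^ n) (u - f) - l ^ n • (u - f)) := by
    rw [map_sub, smul_sub]
    abel
  have hscalar : ‖l ^ n • (u - f)‖ ≤ ‖u - f‖ := by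
    rw [norm_smul, norm_pow]
    exact mul_le_of_le_one_left (norm_nonneg _) (pow_le_one₀ (norm_nonneg _) hl)
  calc ‖(R ^ n) u - l ^ n • u‖
      ≤ ‖(R ^ n) f - l ^ n • f‖ + (‖(R ^ n) (u - f)‖ + ‖l ^ n • (u - f)‖) := by
        rw [hsplit]
        exact (norm_add_le _ _).trans (add_le_add_right (norm_sub_le _ _) _)
    _ ≤ n * ‖R f - l • f‖ + (‖u - f‖ + ‖u - f‖) := by
        gcongr
        exacts [norm_pow_apply_sub_pow_smul_le hR hl n f, norm_pow_apply_le hR n _]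
    _ = n * ‖R f - l • f‖ + 2 * ‖u - f‖ := by ring

/-- The corrector `g` enters through `f = u - g / n`, which turns the error `b - c u` of the
approximate eigenvalue equation for `u` into `b - c u - (g - Q g)`. -/
theorem tendsto_nat_mul_norm_apply_sub_exp_smul [NormedSpace ℂ E] {Q : E →L[ℂ] E}
    {R : ℕ → E →L[ℂ] E} (hRQ : ∀ g, Tendsto (fun n => R n g) atTop (𝓝 (Q g))) {u b : E} (c : ℂ)
    (hu : Tendsto (fun n : ℕ => (n : ℂ) • (R n u - u)) atTop (𝓝 (-b))) (g : E) :
    Tendsto (fun n : ℕ => n * ‖R n (u - (n : ℂ)⁻¹ • g)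
        - Complex.exp (-c / n) • (u - (n : ℂ)⁻¹ • g)‖) atTop (𝓝 ‖b - c • u - (g - Q g)‖) := by
  have hexp : Tendsto (fun n : ℕ => Complex.exp (-c / n)) atTop (𝓝 1) := by
    simpa [Function.comp_def] using (Complex.continuous_exp.tendsto 0).comp
      (tendsto_const_div_atTop_nhds_zero_nat (-c))
  have hlim := ((hu.sub ((tendsto_nat_mul_exp_neg_div_sub_one c).smul_const u)).sub
    (hRQ g)).add (hexp.smul_const g)
  have hval : -b - -c • u - Q g + (1 : ℂ) • g = -(b - c • u - (g - Q g)) := by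
    rw [one_smul, neg_smul]
    abel
  rw [hval] at hlim
  rw [← norm_neg (b - c • u - (g - Q g))]
  refine hlim.norm.congr' ?_
  filter_upwards [eventually_ne_atTop 0] with n hn
  have hn : (n : ℂ) ≠ 0 := Nat.cast_ne_zero.2 hn
  rw [← Complex.norm_natCast n, ← norm_smul]
  congr 1
  simp only [map_sub, map_smul, smul_sub, smul_smul, mul_sub, sub_smul, mul_inv_cancel₀ hn,
    mul_left_comm (n : ℂ) _ (n : ℂ)⁻¹, mul_one, one_smul]
  abel

theorem tendsto_pow_apply_of_mem_closure_range_sub [NormedSpace ℂ E] {Q : E →L[ℂ] E}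
    {R : ℕ → E →L[ℂ] E} (hR : ∀ n, ‖R n‖ ≤ 1)
    (hRQ : ∀ g, Tendsto (fun n => R n g) atTop (𝓝 (Q g))) {u b : E} {c : ℂ} (hc : 0 ≤ c.re)
    (hu : Tendsto (fun n : ℕ => (n : ℂ) • (R n u - u)) atTop (𝓝 (-b)))
    (hb : b - c • u ∈ closure (Set.range fun g => g - Q g)) :
    Tendsto (fun n => (R n ^ n) u) atTop (𝓝 (Complex.exp (-c) • u)) := by
  rw [tendsto_iff_norm_sub_tendsto_zero]
  refine tendsto_order.2 ⟨fun a ha => .of_forall fun n => ha.trans_le (norm_nonneg _),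
    fun ε hε => ?_⟩
  obtain ⟨_, ⟨g, rfl⟩, hg⟩ := Metric.mem_closure_iff.1 hb ε hε
  rw [dist_eq_norm] at hg
  have hcorr : Tendsto (fun n : ℕ => 2 * ‖u - (u - (n : ℂ)⁻¹ • g)‖) atTop (𝓝 0) := by
    have := ((tendsto_inv_atTop_nhds_zero_nat (𝕜 := ℂ)).smul_const g).norm.const_mul 2
    simpa only [sub_sub_cancel, zero_smul, norm_zero, mul_zero] using this
  have hbound := (tendsto_nat_mul_norm_apply_sub_exp_smul hRQ c hu g).add hcorr
  rw [add_zero] at hbound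
  filter_upwards [hbound.eventually_lt_const hg, eventually_ne_atTop 0] with n hlt hn
  have hn : (n : ℂ) ≠ 0 := Nat.cast_ne_zero.2 hn
  have hpow : Complex.exp (-c / n) ^ n = Complex.exp (-c) := by
    rw [← Complex.exp_nat_mul, mul_div_cancel₀ _ hn]
  have hle : ‖Complex.exp (-c / n)‖ ≤ 1 := by
    rw [Complex.norm_exp, Real.exp_le_one_iff, Complex.div_natCast_re, Complex.neg_re]
    exact div_nonpos_of_nonpos_of_nonneg (neg_nonpos.2 hc) n.cast_nonneg
  have h := norm_pow_apply_sub_pow_smul_le_add (hR n) hle n u (u - (n : ℂ)⁻¹ • g)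
  rw [hpow] at h
  exact h.trans_lt hlt

theorem mem_closure_range_sub_of_forall_fixed_inner_eq_zero {𝕜 : Type*} [RCLike 𝕜]
    [InnerProductSpace 𝕜 E] [CompleteSpace E] {Q : E →L[𝕜] E} (hQ : ‖Q‖ ≤ 1) {b : E}
    (hb : ∀ h, Q h = h → inner 𝕜 h b = 0) : b ∈ closure (Set.range fun g => g - Q g) := by
  let K : Submodule 𝕜 E := LinearMap.range ((1 - Q : E →L[𝕜] E) : E →ₗ[𝕜] E)
  change b ∈ (K.topologicalClosure : Set E)
  rw [← Submodule.orthogonal_orthogonal_eq_closure, SetLike.mem_coe, Submodule.mem_orthogonal]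
  intro h hh
  have hinner : inner 𝕜 (Q h) h = inner 𝕜 h h := by
    have := (Submodule.mem_orthogonal K h).1 hh _ ⟨h, rfl⟩
    exact (sub_eq_zero.1 ((inner_sub_left h (Q h) h).symm.trans this)).symm
  refine hb h (eq_of_norm_le_re_inner_eq_norm_sq (𝕜 := 𝕜) ?_ ?_)
  · simpa only [one_mul] using Q.le_of_opNorm_le hQ h
  · rw [hinner, inner_self_eq_norm_sq]

end Contraction

theorem sum_mul_norm_sub_sq {ι F : Type*} [NormedAddCommGroup F] [InnerProductSpace ℝ F]
    {s : Finset ι} {p : ι → ℝ} (hp : ∑ i ∈ s, p i = 1) {v : ι → F} {m : F}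
    (hm : ∑ i ∈ s, p i • v i = m) :
    ∑ i ∈ s, p i * ‖v i - m‖ ^ 2 = ∑ i ∈ s, p i * ‖v i‖ ^ 2 - ‖m‖ ^ 2 := by
  have hexpand : ∀ i, p i * ‖v i - m‖ ^ 2
      = p i * ‖v i‖ ^ 2 - 2 * inner ℝ (p i • v i) m + p i * ‖m‖ ^ 2 := fun i => by
    rw [norm_sub_sq_real, real_inner_smul_left]
    ring
  simp_rw [hexpand]
  rw [Finset.sum_add_distrib, Finset.sum_sub_distrib, ← Finset.mul_sum, ← sum_inner, hm,
    ← Finset.sum_mul, hp, real_inner_self_eq_norm_sq]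
  ring

/-! ### The environment seen from the particle -/

theorem norm_sq_eq_integral {α 𝕜 E : Type*} [RCLike 𝕜] [NormedAddCommGroup E]
    [InnerProductSpace 𝕜 E] {_ : MeasurableSpace α} {μ : Measure α} (f : Lp E 2 μ) :
    ‖f‖ ^ 2 = ∫ a, ‖f a‖ ^ 2 ∂μ := by
  rw [← inner_self_eq_norm_sq (𝕜 := 𝕜) f, L2.inner_def, ← integral_re (L2.integrable_inner f f)]
  simp only [inner_self_eq_norm_sq]

theorem integrable_norm_sq {α E : Type*} [NormedAddCommGroup E] {_ : MeasurableSpace α}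
    {μ : Measure α} (f : Lp E 2 μ) : Integrable (fun a => ‖f a‖ ^ 2) μ :=
  (memLp_two_iff_integrable_sq_norm (Lp.aestronglyMeasurable f)).1 (Lp.memLp f)

theorem inner_const_left {α 𝕜 : Type*} [RCLike 𝕜] {_ : MeasurableSpace α} {μ : Measure α}
    [IsFiniteMeasure μ] (c : 𝕜) (f : Lp 𝕜 2 μ) :
    inner 𝕜 (Lp.const 2 μ c) f = starRingEnd 𝕜 c * ∫ a, f a ∂μ := by
  rw [L2.inner_def, ← integral_const_mul]
  refine integral_congr_ae ?_
  filter_upwards [Lp.coeFn_const 2 μ c] with a ha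
  rw [ha, Function.const_apply, RCLike.inner_apply, mul_comm]

theorem inner_const_one_self {α 𝕜 : Type*} [RCLike 𝕜] {_ : MeasurableSpace α} {μ : Measure α}
    [IsProbabilityMeasure μ] : inner 𝕜 (Lp.const 2 μ (1 : 𝕜)) (Lp.const 2 μ (1 : 𝕜)) = 1 := by
  rw [inner_const_left, integral_congr_ae (Lp.coeFn_const 2 μ (1 : 𝕜))]
  simp

theorem ae_forall_vadd (G : Type*) {Ω : Type*} [AddGroup G] [Countable G] [AddAction G Ω]
    [MeasurableSpace Ω] [MeasurableConstVAdd G Ω] {P : Measure Ω} [VAddInvariantMeasure G Ω P]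
    {A : Ω → Prop} (hA : ∀ᵐ ω ∂P, A ω) : ∀ᵐ ω ∂P, ∀ g : G, A (g +ᵥ ω) :=
  ae_all_iff.2 fun g => (measurePreserving_vadd g P).quasiMeasurePreserving.ae hA

theorem ae_eq_const_of_forall_vadd_ae_eq {G Ω X : Type*} [AddGroup G] [AddAction G Ω]
    [MeasurableSpace Ω] {P : Measure Ω} [ErgodicVAdd G Ω P] [MeasurableSpace X]
    [MeasurableSpace.CountablySeparated X] [Nonempty X] {h : Ω → X} (hm : AEMeasurable h P)
    (hinv : ∀ g : G, ∀ᵐ ω ∂P, h (g +ᵥ ω) = h ω) : ∃ c, h =ᵐ[P] Function.const Ω c := by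
  refine exists_eventuallyEq_const_of_forall_separating MeasurableSet fun U hU => ?_
  have hconst : EventuallyConst (h ⁻¹' U) (ae P) :=
    aeconst_of_forall_preimage_vadd_ae_eq G (hm.nullMeasurable hU) fun g =>
      (hinv g).mono fun ω hω => congrArg (· ∈ U) hω
  rcases eventuallyConst_set'.1 hconst with hempty | huniv
  · exact .inr (hempty.mem_iff.mono fun ω hω => by simpa using hω)
  · exact .inl (huniv.mem_iff.mono fun ω hω => by simpa using hω)

namespace Environment

variable {d : ℕ} {Ω : Type*} [MeasurableSpace Ω] [AddAction (Zd d) Ω] (env : Environment d Ω)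

theorem p_le_one (ω : Ω) (x y : Zd d) : env.p ω x y ≤ 1 :=
  le_hasSum (env.hasSum_row ω x) y fun z _ => env.nonneg ω x z

theorem p_eq_zero_of_notMem {ω : Ω} {y : Zd d} (hy : y ∉ env.Λ) : env.p ω 0 y = 0 :=
  env.finite_range ω 0 y (by rwa [sub_zero])

theorem hasSum_transition {E : Type*} [AddCommMonoid E] [Module ℝ E] [TopologicalSpace E]
    (ω : Ω) (f : Zd d → E) :
    HasSum (fun y => env.p ω 0 y • f y) (∑ y ∈ env.Λ, env.p ω 0 y • f y) :=
  hasSum_sum_of_ne_finset_zero fun y hy => by rw [env.p_eq_zero_of_notMem hy, zero_smul]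

theorem sum_transition (ω : Ω) : ∑ y ∈ env.Λ, env.p ω 0 y = 1 := by
  simpa using (env.hasSum_transition ω (fun _ => (1 : ℝ))).unique
    (by simpa using env.hasSum_row ω 0)

theorem sum_transition_neg (ω : Ω) : ∑ y ∈ env.Λ, env.p ω (-y) 0 = 1 :=
  (hasSum_sum_of_ne_finset_zero fun y hy => env.finite_range ω (-y) 0 (by simpa using hy)).unique
    ((Equiv.neg (Zd d)).hasSum_iff.2 (env.hasSum_col ω 0))

theorem sum_transition_smul_toEuclid (ω : Ω) : ∑ y ∈ env.Λ, env.p ω 0 y • toEuclid y = 0 :=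
  (env.hasSum_transition ω toEuclid).unique (by simpa using env.zero_drift ω 0)

theorem nStep_nonneg (ω : Ω) (n : ℕ) (x y : Zd d) : 0 ≤ env.nStep ω n x y := by
  induction n generalizing x with
  | zero =>
    simp only [nStep]
    split_ifs <;> norm_num
  | succ n ih => exact tsum_nonneg fun z => mul_nonneg (env.nonneg ω x z) (ih z)

theorem eq_of_nStep_pos {ω : Ω} {X : Type*} {h : Zd d → X}
    (hh : ∀ x y, 0 < env.p ω x y → h y = h x) {n : ℕ} {x y : Zd d}
    (hxy : 0 < env.nStep ω n x y) : h y = h x := by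
  induction n generalizing x with
  | zero =>
    by_cases heq : x = y
    · rw [heq]
    · simp [nStep, heq] at hxy
  | succ n ih =>
    obtain ⟨z, hz⟩ : ∃ z, env.p ω x z * env.nStep ω n z y ≠ 0 := by
      by_contra! hcon
      simp [nStep, hcon] at hxy
    have hjump : 0 < env.p ω x z := (env.nonneg ω x z).lt_of_ne' (left_ne_zero_of_mul hz)
    have htail : 0 < env.nStep ω n z y :=
      (env.nStep_nonneg ω n z y).lt_of_ne' (right_ne_zero_of_mul hz)
    exact (ih htail).trans (hh x z hjump)

section StepOp

variable {E : Type*} [AddCommMonoid E] [Module ℝ E]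

/-- The transition operator `f ↦ (x ↦ ∑ y, p_{xy}(ω) f y)` of the walk in the environment `ω`,
written as a finite sum over the possible jumps. -/
noncomputable def stepOp (ω : Ω) (f : Zd d → E) (x : Zd d) : E :=
  ∑ z ∈ env.Λ, env.p ω x (x + z) • f (x + z)

theorem hasSum_stepOp [TopologicalSpace E] (ω : Ω) (f : Zd d → E) (x : Zd d) :
    HasSum (fun y => env.p ω x y • f y) (env.stepOp ω f x) :=
  (Equiv.addLeft x).hasSum_iff.1 <| hasSum_sum_of_ne_finset_zero fun z hz => by
    simp only [Function.comp_apply, Equiv.coe_addLeft]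
    rw [env.finite_range ω x (x + z) (by rwa [add_sub_cancel_left]), zero_smul]

theorem stepOp_zero_right (ω : Ω) (f : Zd d → E) :
    env.stepOp ω f 0 = ∑ y ∈ env.Λ, env.p ω 0 y • f y := by
  simp only [stepOp, zero_add]

theorem semiconj_stepOp_vadd (ω : Ω) (z : Zd d) :
    Function.Semiconj (fun (f : Zd d → E) x => f (x + z)) (env.stepOp ω)
      (env.stepOp (z +ᵥ ω)) := fun f => by
  funext x
  simp only [stepOp, env.equivariant, add_right_comm]

theorem iterate_stepOp_addChar (ω : Ω) (χ : AddChar (Zd d) ℂ) (n : ℕ) (y : Zd d) :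
    (env.stepOp ω)^[n] χ y = χ y * (env.stepOp (y +ᵥ ω))^[n] χ 0 := by
  have hscalar : Function.Commute (fun (f : Zd d → ℂ) x => χ y * f x) (env.stepOp (y +ᵥ ω)) :=
    fun f => by
      funext x
      simp only [stepOp, Finset.mul_sum, mul_smul_comm]
  have hshift := congrFun ((env.semiconj_stepOp_vadd ω y).iterate_right n χ) 0
  simp only [AddChar.map_add_eq_mul, mul_comm _ (χ y), zero_add] at hshift
  rw [hshift]
  exact (congrFun (hscalar.iterate_right n χ) 0).symm

end StepOp

section TransferOp

variable (P : Measure Ω)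

theorem memLp_top_transition (y : Zd d) : MemLp (fun ω => (env.p ω 0 y : ℂ)) ⊤ P :=
  memLp_top_of_bound
    (Complex.measurable_ofReal.comp (env.measurable_p 0 y)).aestronglyMeasurable 1
    (.of_forall fun ω => by
      rw [Complex.norm_real, Real.norm_of_nonneg (env.nonneg ω 0 y)]
      exact env.p_le_one ω 0 y)

variable [MeasurableConstVAdd (Zd d) Ω] [VAddInvariantMeasure (Zd d) Ω P]

theorem integrable_transition {f : Ω → ℝ} (hf : Integrable f P) (y : Zd d) :
    Integrable (fun ω => env.p ω 0 y * f (y +ᵥ ω)) P :=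
  ((measurePreserving_vadd y P).integrable_comp_of_integrable hf).bdd_mul (c := 1)
    (env.measurable_p 0 y).aestronglyMeasurable
    (.of_forall fun ω => by
      rw [Real.norm_of_nonneg (env.nonneg ω 0 y)]
      exact env.p_le_one ω 0 y)

/-- Bistochasticity enters only here: it makes `P` invariant for the environment seen from the
particle. -/
theorem integral_sum_transition {f : Ω → ℝ} (hf : Integrable f P) :
    ∫ ω, ∑ y ∈ env.Λ, env.p ω 0 y * f (y +ᵥ ω) ∂P = ∫ ω, f ω ∂P := by
  have hback (y : Zd d) (ω : Ω) :
      env.p (-y +ᵥ ω) 0 y * f (y +ᵥ (-y +ᵥ ω)) = env.p ω (-y) 0 * f ω := by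
    simp only [env.equivariant, zero_add, add_neg_cancel, vadd_neg_vadd]
  have hint (y : Zd d) : Integrable (fun ω => env.p ω (-y) 0 * f ω) P := by
    simpa only [Function.comp_def, hback] using
      (measurePreserving_vadd (-y) P).integrable_comp_of_integrable
        (env.integrable_transition P hf y)
  calc ∫ ω, ∑ y ∈ env.Λ, env.p ω 0 y * f (y +ᵥ ω) ∂P
      = ∑ y ∈ env.Λ, ∫ ω, env.p ω 0 y * f (y +ᵥ ω) ∂P :=
        integral_finsetSum _ fun y _ => env.integrable_transition P hf y
    _ = ∑ y ∈ env.Λ, ∫ ω, env.p ω (-y) 0 * f ω ∂P := Finset.sum_congr rfl fun y _ => by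
        rw [← (measurePreserving_vadd (-y) P).integral_comp (measurableEmbedding_const_vadd (-y))]
        simp only [hback]
    _ = ∫ ω, ∑ y ∈ env.Λ, env.p ω (-y) 0 * f ω ∂P :=
        (integral_finsetSum _ fun y _ => hint y).symm
    _ = ∫ ω, f ω ∂P := by simp only [← Finset.sum_mul, env.sum_transition_neg, one_mul]

/-- The operator `f ↦ (ω ↦ p_{0y}(ω) f(τ_y ω))` on `L²(P)`. -/
noncomputable def jumpOp (y : Zd d) : Lp ℂ 2 P →L[ℂ] Lp ℂ 2 P :=
  (ContinuousLinearMap.mul ℂ ℂ).holderL P ⊤ 2 2 ((env.memLp_top_transition P y).toLp _) ∘L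
    (Lp.compMeasurePreservingₗᵢ ℂ (y +ᵥ ·) (measurePreserving_vadd y P)).toContinuousLinearMap

theorem coeFn_jumpOp (y : Zd d) (f : Lp ℂ 2 P) :
    env.jumpOp P y f =ᵐ[P] fun ω => (env.p ω 0 y : ℂ) * f (y +ᵥ ω) := by
  have hmul := (ContinuousLinearMap.mul ℂ ℂ).coeFn_holder (r := 2)
    ((env.memLp_top_transition P y).toLp _)
    (Lp.compMeasurePreserving (y +ᵥ ·) (measurePreserving_vadd y P) f)
  filter_upwards [hmul, (env.memLp_top_transition P y).coeFn_toLp,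
    Lp.coeFn_compMeasurePreserving f (measurePreserving_vadd y P)] with ω h hp hf
  exact h.trans (by rw [ContinuousLinearMap.mul_apply', hp, hf, Function.comp_apply])

/-- The transition operator of the environment seen from the particle on `L²(P)`, with the jump
`y` weighted by `w y`; it is linear and continuous in the weight. -/
noncomputable def transferOp : (Zd d → ℂ) →L[ℂ] Lp ℂ 2 P →L[ℂ] Lp ℂ 2 P :=
  ∑ y ∈ env.Λ, (ContinuousLinearMap.proj (R := ℂ) (φ := fun _ : Zd d => ℂ) y).smulRight
    (env.jumpOp P y)

theorem transferOp_apply (w : Zd d → ℂ) (f : Lp ℂ 2 P) :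
    env.transferOp P w f = ∑ y ∈ env.Λ, w y • env.jumpOp P y f := by
  simp [transferOp]

theorem coeFn_transferOp (w : Zd d → ℂ) (f : Lp ℂ 2 P) :
    env.transferOp P w f =ᵐ[P] fun ω => ∑ y ∈ env.Λ, env.p ω 0 y • (w y * f (y +ᵥ ω)) := by
  rw [transferOp_apply]
  filter_upwards [Lp.coeFn_finsetSum env.Λ fun y => w y • env.jumpOp P y f,
    ae_all_iff.2 fun y => Lp.coeFn_smul (w y) (env.jumpOp P y f),
    ae_all_iff.2 fun y => env.coeFn_jumpOp P y f] with ω hsum hsmul hjump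
  rw [hsum, Finset.sum_apply]
  refine Finset.sum_congr rfl fun y _ => ?_
  rw [hsmul, Pi.smul_apply, hjump, smul_eq_mul, Complex.real_smul, mul_left_comm]

theorem tendsto_transferOp_apply {ι : Type*} {l : Filter ι} {w : ι → Zd d → ℂ} {w₀ : Zd d → ℂ}
    (hw : ∀ y, Tendsto (fun i => w i y) l (𝓝 (w₀ y))) (f : Lp ℂ 2 P) :
    Tendsto (fun i => env.transferOp P (w i) f) l (𝓝 (env.transferOp P w₀ f)) := by
  simp only [transferOp_apply]
  exact tendsto_finsetSum _ fun y _ => (hw y).smul_const _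

theorem norm_transferOp_le_one {w : Zd d → ℂ} (hw : ∀ y, ‖w y‖ ≤ 1) : ‖env.transferOp P w‖ ≤ 1 := by
  refine ContinuousLinearMap.opNorm_le_bound _ zero_le_one fun f => ?_
  rw [one_mul, ← sq_le_sq₀ (norm_nonneg _) (norm_nonneg _), norm_sq_eq_integral (𝕜 := ℂ),
    norm_sq_eq_integral (𝕜 := ℂ), ← env.integral_sum_transition P (integrable_norm_sq f)]
  refine integral_mono_ae (integrable_norm_sq _)
    (integrable_finsetSum _ fun y _ => env.integrable_transition P (integrable_norm_sq f) y) ?_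
  filter_upwards [env.coeFn_transferOp P w f] with ω hω
  calc ‖env.transferOp P w f ω‖ ^ 2
      ≤ (∑ y ∈ env.Λ, env.p ω 0 y * ‖f (y +ᵥ ω)‖) ^ 2 := by
        rw [hω]
        gcongr
        refine norm_sum_le_of_le _ fun y _ => ?_
        rw [norm_smul, norm_mul, Real.norm_of_nonneg (env.nonneg ω 0 y)]
        exact mul_le_mul_of_nonneg_left (mul_le_of_le_one_left (norm_nonneg _) (hw y))
          (env.nonneg ω 0 y)
    _ ≤ ∑ y ∈ env.Λ, env.p ω 0 y * ‖f (y +ᵥ ω)‖ ^ 2 :=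
        Real.pow_arith_mean_le_arith_mean_pow _ _ _ (fun y _ => env.nonneg ω 0 y)
          (env.sum_transition ω) (fun y _ => norm_nonneg _) 2

theorem ae_eq_of_transferOp_one_eq {h : Lp ℂ 2 P} (hh : env.transferOp P 1 h = h) :
    ∀ᵐ ω ∂P, ∀ y, 0 < env.p ω 0 y → h (y +ᵥ ω) = h ω := by
  have hharmonic : ∀ᵐ ω ∂P, ∑ y ∈ env.Λ, env.p ω 0 y • h (y +ᵥ ω) = h ω := by
    have hcoe := env.coeFn_transferOp P 1 h
    rw [hh] at hcoe
    filter_upwards [hcoe] with ω hω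
    simpa only [Pi.one_apply, one_mul] using hω.symm
  have hsq := integrable_norm_sq h
  have hsum := integrable_finsetSum env.Λ fun y _ => env.integrable_transition P hsq y
  have hvariance : ∀ᵐ ω ∂P, ∑ y ∈ env.Λ, env.p ω 0 y * ‖h (y +ᵥ ω) - h ω‖ ^ 2
      = ∑ y ∈ env.Λ, env.p ω 0 y * ‖h (y +ᵥ ω)‖ ^ 2 - ‖h ω‖ ^ 2 :=
    hharmonic.mono fun ω hω => sum_mul_norm_sub_sq (env.sum_transition ω) hω
  have hnonneg (ω : Ω) (y : Zd d) : 0 ≤ env.p ω 0 y * ‖h (y +ᵥ ω) - h ω‖ ^ 2 :=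
    mul_nonneg (env.nonneg ω 0 y) (sq_nonneg _)
  have hzero : ∀ᵐ ω ∂P, ∑ y ∈ env.Λ, env.p ω 0 y * ‖h (y +ᵥ ω) - h ω‖ ^ 2 = 0 := by
    refine (integral_eq_zero_iff_of_nonneg_ae
      (.of_forall fun ω => Finset.sum_nonneg fun y _ => hnonneg ω y)
      ((hsum.sub hsq).congr (hvariance.mono fun ω hω => hω.symm))).1 ?_
    rw [integral_congr_ae hvariance, integral_sub hsum hsq, env.integral_sum_transition P hsq,
      sub_self]
  filter_upwards [hzero] with ω hω y hy
  have hyΛ : y ∈ env.Λ := not_imp_comm.1 env.p_eq_zero_of_notMem hy.ne'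
  have hterm := (Finset.sum_eq_zero_iff_of_nonneg fun y _ => hnonneg ω y).1 hω y hyΛ
  simpa [hy.ne', sub_eq_zero] using hterm

theorem ae_eq_vadd_of_ae_eq_of_jump {X : Type*} (hirr : env.AlmostSurelyIrreducible P) {h : Ω → X}
    (hjump : ∀ᵐ ω ∂P, ∀ y, 0 < env.p ω 0 y → h (y +ᵥ ω) = h ω) (z : Zd d) :
    ∀ᵐ ω ∂P, h (z +ᵥ ω) = h ω := by
  filter_upwards [ae_forall_vadd (Zd d) hjump, hirr] with ω hω hreach
  obtain ⟨n, -, hn⟩ := hreach z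
  have hstep (x y : Zd d) (hxy : 0 < env.p ω x y) : h (y +ᵥ ω) = h (x +ᵥ ω) := by
    have hsub := hω x (y - x) (by rwa [env.equivariant, zero_add, sub_add_cancel])
    rwa [vadd_vadd, sub_add_cancel] at hsub
  simpa using env.eq_of_nStep_pos (h := fun x => h (x +ᵥ ω)) hstep hn

theorem coeFn_transferOp_const_one [IsFiniteMeasure P] (w : Zd d → ℂ) :
    env.transferOp P w (Lp.const 2 P 1) =ᵐ[P] fun ω => ∑ y ∈ env.Λ, env.p ω 0 y • w y := by
  filter_upwards [env.coeFn_transferOp P w (Lp.const 2 P 1),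
    ae_forall_vadd (Zd d) (Lp.coeFn_const 2 P (1 : ℂ))] with ω h hone
  simp only [h, hone, Function.const_apply, mul_one]

theorem transferOp_const_one_eq_smul [IsFiniteMeasure P] {w : Zd d → ℂ} {c : ℂ}
    (hw : ∀ ω, ∑ y ∈ env.Λ, env.p ω 0 y • w y = c) :
    env.transferOp P w (Lp.const 2 P 1) = c • Lp.const 2 P 1 := by
  refine Lp.ext ?_
  filter_upwards [env.coeFn_transferOp_const_one P w, Lp.coeFn_smul c (Lp.const 2 P (1 : ℂ)),
    Lp.coeFn_const 2 P (1 : ℂ)] with ω h hsmul hone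
  rw [h, hw, hsmul, Pi.smul_apply, hone, Function.const_apply, smul_eq_mul, mul_one]

theorem inner_const_one_transferOp [IsFiniteMeasure P] (w : Zd d → ℂ) :
    inner ℂ (Lp.const 2 P (1 : ℂ)) (env.transferOp P w (Lp.const 2 P 1))
      = ∑ y ∈ env.Λ, (∫ ω, env.p ω 0 y ∂P) • w y := by
  rw [inner_const_left, map_one, one_mul, integral_congr_ae (env.coeFn_transferOp_const_one P w),
    integral_finsetSum]
  · exact Finset.sum_congr rfl fun y _ => integral_smul_const _ _
  · intro y _
    simpa using (env.integrable_transition P (integrable_const 1) y).smul_const (w y)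

theorem coeFn_transferOp_pow_const_one [IsFiniteMeasure P] (χ : AddChar (Zd d) ℂ) (n : ℕ) :
    (env.transferOp P χ ^ n) (Lp.const 2 P 1) =ᵐ[P] fun ω => (env.stepOp ω)^[n] χ 0 := by
  induction n with
  | zero => exact (Lp.coeFn_const 2 P 1).trans (.of_forall fun _ => χ.map_zero_eq_one.symm)
  | succ n ih =>
    rw [pow_succ', mul_apply_eq_comp]
    filter_upwards [env.coeFn_transferOp P χ ((env.transferOp P χ ^ n) (Lp.const 2 P 1)),
      ae_forall_vadd (Zd d) ih] with ω hstep hshift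
    rw [hstep, Function.iterate_succ_apply', env.stepOp_zero_right]
    exact Finset.sum_congr rfl fun y _ => by rw [hshift, env.iterate_stepOp_addChar ω χ n y]

end TransferOp

end Environment

theorem toEuclid_zero {d : ℕ} : toEuclid (0 : Zd d) = 0 := by
  ext α
  simp [toEuclid]

theorem toEuclid_add {d : ℕ} (x y : Zd d) : toEuclid (x + y) = toEuclid x + toEuclid y := by
  ext α
  simp [toEuclid]

/-- The character `x ↦ exp (i ⟨x, t⟩)` of `ℤ^d`. -/
noncomputable def expChar {d : ℕ} (t : EuclideanSpace ℝ (Fin d)) : AddChar (Zd d) ℂ where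
  toFun x := Complex.exp ((inner ℝ (toEuclid x) t : ℝ) * Complex.I)
  map_zero_eq_one' := by simp [toEuclid_zero]
  map_add_eq_mul' x y := by
    rw [toEuclid_add, inner_add_left, Complex.ofReal_add, add_mul, Complex.exp_add]

theorem expChar_apply {d : ℕ} (t : EuclideanSpace ℝ (Fin d)) (x : Zd d) :
    expChar t x = Complex.exp ((inner ℝ (toEuclid x) t : ℝ) * Complex.I) := rfl

theorem norm_expChar {d : ℕ} (t : EuclideanSpace ℝ (Fin d)) (x : Zd d) : ‖expChar t x‖ = 1 :=
  Complex.norm_exp_ofReal_mul_I _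

namespace Environment

variable {d : ℕ} {Ω : Type*} [MeasurableSpace Ω] [AddAction (Zd d) Ω] (env : Environment d Ω)

section CharacteristicFunction

variable [MeasurableConstVAdd (Zd d) Ω] (P : Measure Ω)

theorem mem_closure_range_sub_transferOp_one [IsFiniteMeasure P] [ErgodicVAdd (Zd d) Ω P]
    (hirr : env.AlmostSurelyIrreducible P) {b : Lp ℂ 2 P}
    (hb : inner ℂ (Lp.const 2 P (1 : ℂ)) b = 0) :
    b ∈ closure (Set.range fun g => g - env.transferOp P 1 g) := by
  refine mem_closure_range_sub_of_forall_fixed_inner_eq_zero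
    (env.norm_transferOp_le_one P fun y => norm_one.le) fun h hh => ?_
  obtain ⟨c, hc⟩ := ae_eq_const_of_forall_vadd_ae_eq (Lp.aestronglyMeasurable h).aemeasurable
    (env.ae_eq_vadd_of_ae_eq_of_jump P hirr (env.ae_eq_of_transferOp_one_eq P hh))
  rw [inner_const_left, map_one, one_mul] at hb
  rw [Lp.ext (hc.trans (Lp.coeFn_const 2 P c).symm), inner_const_left, hb, mul_zero]

theorem tendsto_nat_smul_transferOp_exp_const_one [IsFiniteMeasure P]
    [VAddInvariantMeasure (Zd d) Ω P] {x : Zd d → ℝ}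
    (hx : ∀ ω, ∑ y ∈ env.Λ, env.p ω 0 y * x y = 0) :
    Tendsto (fun n : ℕ => (n : ℂ) •
        (env.transferOp P (fun y => Complex.exp (x y * Complex.I / √(n : ℝ))) (Lp.const 2 P 1)
          - Lp.const 2 P 1)) atTop
      (𝓝 (-env.transferOp P (fun y => (x y ^ 2 / 2 : ℂ)) (Lp.const 2 P 1))) := by
  have hone : env.transferOp P 1 (Lp.const 2 P 1) = Lp.const 2 P 1 := by
    simpa using env.transferOp_const_one_eq_smul P (w := 1) (c := 1) fun ω => by
      simpa using congrArg ((↑) : ℝ → ℂ) (env.sum_transition ω)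
  have hdrift : env.transferOp P (fun y => (x y : ℂ)) (Lp.const 2 P 1) = 0 := by
    simpa using env.transferOp_const_one_eq_smul P (c := 0) fun ω => by
      simpa using congrArg ((↑) : ℝ → ℂ) (hx ω)
  have hweights (y : Zd d) := tendsto_nat_mul_exp_div_sqrt_sub_one_sub (x y * Complex.I)
  have hlim := env.tendsto_transferOp_apply P hweights (Lp.const 2 P 1)
  have hsq : (fun y => (x y * Complex.I) ^ 2 / 2) = -fun y => (x y ^ 2 / 2 : ℂ) := by
    funext y
    rw [mul_pow, Complex.I_sq, Pi.neg_apply]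
    ring
  rw [hsq, map_neg, neg_apply] at hlim
  refine hlim.congr fun n => ?_
  have hsplit : (fun y => (n : ℂ) * (Complex.exp (x y * Complex.I / √(n : ℝ)) - 1
      - x y * Complex.I / √(n : ℝ))) = (n : ℂ) •
        ((fun y => Complex.exp (x y * Complex.I / √(n : ℝ))) - 1
          - (Complex.I / √(n : ℝ)) • fun y => (x y : ℂ)) := by
    funext y
    simp only [Pi.smul_apply, Pi.sub_apply, Pi.one_apply, smul_eq_mul]
    ring
  simp only [hsplit, map_smul, map_sub, smul_apply, sub_apply, hone, hdrift, smul_zero, sub_zero]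

variable [IsProbabilityMeasure P] [ErgodicVAdd (Zd d) Ω P]

theorem tendsto_transferOp_exp_pow_const_one (hirr : env.AlmostSurelyIrreducible P)
    {x : Zd d → ℝ} (hx : ∀ ω, ∑ y ∈ env.Λ, env.p ω 0 y * x y = 0) :
    Tendsto (fun n : ℕ =>
        (env.transferOp P (fun y => Complex.exp (x y * Complex.I / √(n : ℝ))) ^ n)
          (Lp.const 2 P 1)) atTop
      (𝓝 (Complex.exp (-((∑ y ∈ env.Λ, (∫ ω, env.p ω 0 y ∂P) * x y ^ 2) / 2 : ℝ)) •
        Lp.const 2 P 1)) := by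
  refine tendsto_pow_apply_of_mem_closure_range_sub (fun n => env.norm_transferOp_le_one P
    fun y => ?_) (Q := env.transferOp P 1) (fun g => ?_) ?_
    (env.tendsto_nat_smul_transferOp_exp_const_one P hx)
    (env.mem_closure_range_sub_transferOp_one P hirr ?_)
  · rw [Complex.norm_exp, Complex.div_ofReal_re, Complex.re_ofReal_mul, Complex.I_re, mul_zero,
      zero_div, Real.exp_zero]
  · refine env.tendsto_transferOp_apply P (fun y => ?_) g
    simpa [Function.comp_def] using (Complex.continuous_exp.tendsto 0).comp
      (tendsto_div_sqrt_nat (x y * Complex.I))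
  · rw [Complex.ofReal_re]
    exact div_nonneg (Finset.sum_nonneg fun y _ => mul_nonneg
      (integral_nonneg fun ω => env.nonneg ω 0 y) (sq_nonneg _)) zero_le_two
  · rw [inner_sub_right, inner_smul_right, inner_const_one_self, inner_const_one_transferOp,
      sub_eq_zero]
    simp [Finset.sum_div, mul_div_assoc]

theorem tendsto_integral_iterate_stepOp_expChar (hirr : env.AlmostSurelyIrreducible P)
    (t : EuclideanSpace ℝ (Fin d)) :
    Tendsto (fun n : ℕ => ∫ ω, (env.stepOp ω)^[n] (expChar ((√(n : ℝ))⁻¹ • t)) 0 ∂P) atTop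
      (𝓝 (Complex.exp (-((∑ y ∈ env.Λ,
        (∫ ω, env.p ω 0 y ∂P) * inner ℝ (toEuclid y) t ^ 2) / 2 : ℝ)))) := by
  have hdrift (ω : Ω) : ∑ y ∈ env.Λ, env.p ω 0 y * inner ℝ (toEuclid y) t = 0 := by
    simp_rw [← real_inner_smul_left]
    rw [← sum_inner, env.sum_transition_smul_toEuclid, inner_zero_left]
  have hchar (n : ℕ) : (fun y => Complex.exp ((inner ℝ (toEuclid y) t : ℝ) * Complex.I
      / √(n : ℝ))) = expChar ((√(n : ℝ))⁻¹ • t) := by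
    funext y
    rw [expChar_apply, real_inner_smul_right]
    push_cast
    ring_nf
  have hlim := (tendsto_const_nhds (x := Lp.const 2 P (1 : ℂ))).inner (𝕜 := ℂ)
    (env.tendsto_transferOp_exp_pow_const_one P hirr hdrift)
  rw [inner_smul_right, inner_const_one_self, mul_one] at hlim
  refine hlim.congr fun n => ?_
  rw [hchar, inner_const_left, map_one, one_mul]
  exact integral_congr_ae (env.coeFn_transferOp_pow_const_one P _ n)

end CharacteristicFunction

end Environment

/-! ### The law of the walk -/

theorem integrable_comp_of_forall_norm_le {S X E : Type*} [MeasurableSpace S] {μ : Measure S}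
    [IsFiniteMeasure μ] [MeasurableSpace X] [DiscreteMeasurableSpace X] [Countable X]
    [NormedAddCommGroup E] {f : X → E} {C : ℝ} (hf : ∀ x, ‖f x‖ ≤ C) {Y : S → X}
    (hY : Measurable Y) : Integrable (fun s => f (Y s)) μ :=
  .of_bound ((StronglyMeasurable.of_discrete (f := f)).comp_measurable hY).aestronglyMeasurable C
    (.of_forall fun _ => hf _)

theorem lebesgueI_apply (A : Set UnitIco) : lebesgueI A = volume (Subtype.val '' A) :=
  (MeasurableEmbedding.subtype_coe measurableSet_Ico).comap_apply _ A

namespace Environment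

variable {d : ℕ} {Ω : Type*} [MeasurableSpace Ω] [AddAction (Zd d) Ω] (env : Environment d Ω)

section PointOfView

variable (e : Fin env.Λ.card ≃ env.Λ)

theorem index_eq_iff {s : UnitIco} {ω : Ω} {i : Fin env.Λ.card} :
    env.index e s ω = i ↔ s.val ∈ env.interval e ω i :=
  ⟨fun h => h ▸ env.index_spec e s ω,
    fun h => (env.existsUnique_index e ω s).unique (env.index_spec e s ω) h⟩

theorem measurable_q (i : Fin env.Λ.card) : Measurable fun ω => env.q e ω i :=
  env.measurable_p 0 _

theorem measurable_cut (k : ℕ) : Measurable fun ω => env.cut e ω k :=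
  Finset.measurable_sum _ fun i _ => env.measurable_q e i

theorem measurable_index : Measurable fun x : UnitIco × Ω => env.index e x.1 x.2 := by
  refine measurable_to_countable' fun i => ?_
  have hpreimage : (fun x : UnitIco × Ω => env.index e x.1 x.2) ⁻¹' {i} =
      {x | env.cut e x.2 i.val ≤ x.1.val} ∩ {x | x.1.val < env.cut e x.2 (i.val + 1)} := by
    ext x
    exact env.index_eq_iff e
  rw [hpreimage]
  have hval : Measurable fun x : UnitIco × Ω => x.1.val :=
    measurable_subtype_coe.comp measurable_fst
  exact (measurableSet_le ((env.measurable_cut e _).comp measurable_snd) hval).inter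
    (measurableSet_lt hval ((env.measurable_cut e _).comp measurable_snd))

theorem measurable_displacement : Measurable (env.displacement e) :=
  (Measurable.of_discrete (f := fun i => (e i : Zd d))).comp (env.measurable_index e)

theorem measurable_phi : Measurable (env.phi e) := by
  have hq : Measurable fun x : Fin env.Λ.card × UnitIco × Ω => env.q e x.2.2 x.1 :=
    measurable_from_prod_countable_right fun i => (env.measurable_q e i).comp measurable_snd
  have hcut : Measurable fun x : Fin env.Λ.card × UnitIco × Ω => env.cut e x.2.2 x.1.val :=
    measurable_from_prod_countable_right fun i =>
      (env.measurable_cut e i.val).comp measurable_snd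
  have hindex := (env.measurable_index e).prodMk measurable_id
  exact ((hq.comp hindex).inv.mul
    ((measurable_subtype_coe.comp measurable_fst).sub (hcut.comp hindex))).subtype_mk

theorem measurable_povMap [MeasurableConstVAdd (Zd d) Ω] : Measurable (env.povMap e) := by
  have hvadd : Measurable fun x : Zd d × Ω => x.1 +ᵥ x.2 :=
    measurable_from_prod_countable_right fun z => measurable_const_vadd z
  exact (env.measurable_phi e).prodMk
    (hvadd.comp ((env.measurable_displacement e).prodMk measurable_snd))

theorem measurable_walk [MeasurableConstVAdd (Zd d) Ω] (n : ℕ) : Measurable (env.walk e n) :=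
  Finset.measurable_sum _ fun k _ =>
    (env.measurable_displacement e).comp ((env.measurable_povMap e).iterate k)

theorem walk_succ (n : ℕ) (x : UnitIco × Ω) :
    env.walk e (n + 1) x = env.displacement e x + env.walk e n (env.povMap e x) := by
  simp only [walk, Finset.sum_range_succ', Function.iterate_succ_apply, Function.iterate_zero,
    id_eq]
  exact add_comm _ _

theorem q_index_pos (s : UnitIco) (ω : Ω) : 0 < env.q e ω (env.index e s ω) := by
  obtain ⟨hle, hlt⟩ := env.index_spec e s ω
  rw [cut_succ] at hlt
  linarith

theorem cut_add_q_mul_phi (s : UnitIco) (ω : Ω) :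
    env.cut e ω (env.index e s ω).val
      + env.q e ω (env.index e s ω) * (env.phi e (s, ω)).val = s.val := by
  simp only [phi]
  rw [mul_inv_cancel_left₀ (env.q_index_pos e s ω).ne', add_sub_cancel]

theorem exists_index_eq_and_phi_eq {ω : Ω} {i : Fin env.Λ.card} (hq : 0 < env.q e ω i)
    (t : UnitIco) : ∃ s : UnitIco, env.index e s ω = i ∧ env.phi e (s, ω) = t ∧
      s.val = env.cut e ω i.val + env.q e ω i * t.val := by
  have hle : 0 ≤ env.q e ω i * t.val := mul_nonneg hq.le t.2.1
  have hlt : env.q e ω i * t.val < env.q e ω i := mul_lt_of_lt_one_right hq t.2.2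
  have hmem : env.cut e ω i.val + env.q e ω i * t.val ∈ env.interval e ω i := by
    rw [interval, cut_succ]
    exact ⟨by linarith, by linarith⟩
  have hnonneg : 0 ≤ env.cut e ω i.val := by
    simpa only [cut_zero] using env.cut_mono e ω i.val.zero_le
  have hle_one : env.cut e ω (i.val + 1) ≤ 1 := by
    simpa only [cut_card] using env.cut_mono e ω i.isLt
  let s : UnitIco := ⟨_, hnonneg.trans hmem.1, hmem.2.trans_le hle_one⟩
  have hindex : env.index e s ω = i := (env.index_eq_iff e).2 hmem
  refine ⟨s, hindex, Subtype.ext ?_, rfl⟩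
  have hs := env.cut_add_q_mul_phi e s ω
  rw [hindex] at hs
  exact mul_left_cancel₀ hq.ne' (add_left_cancel hs)

open scoped Pointwise in
theorem image_phi_preimage_inter {ω : Ω} {i : Fin env.Λ.card} (hq : 0 < env.q e ω i)
    (A : Set UnitIco) :
    Subtype.val '' ((fun s => env.phi e (s, ω)) ⁻¹' A ∩ {s | env.index e s ω = i})
      = env.cut e ω i.val +ᵥ env.q e ω i • (Subtype.val '' A) := by
  simp only [← Set.image_smul, ← Set.image_vadd, Set.image_image, smul_eq_mul, vadd_eq_add]
  apply Set.Subset.antisymm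
  · rintro _ ⟨s, ⟨hs, rfl⟩, rfl⟩
    exact ⟨env.phi e (s, ω), hs, env.cut_add_q_mul_phi e s ω⟩
  · rintro _ ⟨t, ht, rfl⟩
    obtain ⟨s, hindex, rfl, hs⟩ := env.exists_index_eq_and_phi_eq e hq t
    exact ⟨s, ⟨ht, hindex⟩, hs⟩

open scoped Pointwise in
theorem map_restrict_phi (ω : Ω) (i : Fin env.Λ.card) :
    (lebesgueI.restrict {s | env.index e s ω = i}).map (fun s => env.phi e (s, ω))
      = ENNReal.ofReal (env.q e ω i) • lebesgueI := by
  have hphi : Measurable fun s => env.phi e (s, ω) :=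
    (env.measurable_phi e).comp measurable_prodMk_right
  ext A hA
  rw [Measure.map_apply hphi hA, Measure.restrict_apply (hphi hA), Measure.smul_apply,
    lebesgueI_apply, lebesgueI_apply, smul_eq_mul]
  rcases (env.nonneg ω 0 (e i)).eq_or_lt with hq | hq
  · have hempty : {s | env.index e s ω = i} = ∅ := by
      refine Set.eq_empty_of_forall_notMem ?_
      rintro s rfl
      exact (env.q_index_pos e s ω).ne hq
    have hq : env.q e ω i = 0 := hq.symm
    simp [hempty, hq]
  · have hq : 0 < env.q e ω i := hq
    rw [env.image_phi_preimage_inter e hq, measure_vadd, Measure.addHaar_smul,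
      Module.finrank_self, pow_one, abs_of_pos hq]

theorem setIntegral_index_phi {E : Type*} [NormedAddCommGroup E] [NormedSpace ℝ E] (ω : Ω)
    (i : Fin env.Λ.card) {g : UnitIco → E} (hg : AEStronglyMeasurable g lebesgueI) :
    ∫ s in {s | env.index e s ω = i}, g (env.phi e (s, ω)) ∂lebesgueI
      = env.q e ω i • ∫ s, g s ∂lebesgueI := by
  have hphi : Measurable fun s => env.phi e (s, ω) :=
    (env.measurable_phi e).comp measurable_prodMk_right
  have hmap := env.map_restrict_phi e ω i
  have hq : 0 ≤ env.q e ω i := env.nonneg ω 0 (e i)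
  rw [← integral_map hphi.aemeasurable (hmap ▸ hg.smul_measure _), hmap, integral_smul_measure,
    ENNReal.toReal_ofReal hq]

/-- Under Lebesgue measure the displacement has law `p_{0·}(ω)` and the new internal variable is
again uniform and independent of it. -/
theorem integral_displacement_phi {E : Type*} [NormedAddCommGroup E] [NormedSpace ℝ E] (ω : Ω)
    {g : Zd d → UnitIco → E} (hg : ∀ y, Integrable (g y) lebesgueI) :
    ∫ s, g (env.displacement e (s, ω)) (env.phi e (s, ω)) ∂lebesgueI
      = ∑ y ∈ env.Λ, env.p ω 0 y • ∫ s, g y s ∂lebesgueI := by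
  have hphi : Measurable fun s => env.phi e (s, ω) :=
    (env.measurable_phi e).comp measurable_prodMk_right
  have hmeas (i : Fin env.Λ.card) : MeasurableSet {s | env.index e s ω = i} :=
    ((env.measurable_index e).comp measurable_prodMk_right) (measurableSet_singleton i)
  have hcongr (i : Fin env.Λ.card) : Set.EqOn (fun s => g (e i) (env.phi e (s, ω)))
      (fun s => g (env.displacement e (s, ω)) (env.phi e (s, ω)))
      {s | env.index e s ω = i} := by
    rintro s rfl
    rfl
  have hint (i : Fin env.Λ.card) :
      IntegrableOn (fun s => g (e i) (env.phi e (s, ω))) {s | env.index e s ω = i} lebesgueI := by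
    refine Integrable.comp_measurable ?_ hphi
    rw [env.map_restrict_phi e ω i]
    exact (hg _).smul_measure ENNReal.ofReal_ne_top
  have hcover : ⋃ i, {s | env.index e s ω = i} = Set.univ :=
    Set.iUnion_eq_univ_iff.2 fun s => ⟨_, rfl⟩
  have hdisj : Pairwise (Function.onFun Disjoint fun i => {s | env.index e s ω = i}) :=
    fun i j hij => Set.disjoint_left.2 fun s hi hj => hij (hi.symm.trans hj)
  rw [← setIntegral_univ, ← hcover, integral_iUnion_fintype hmeas hdisj fun i =>
    (hint i).congr_fun (hcongr i) (hmeas i), ← Finset.sum_coe_sort env.Λ,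
    ← e.sum_comp]
  refine Finset.sum_congr rfl fun i _ => ?_
  rw [← setIntegral_congr_fun (hmeas i) (hcongr i)]
  exact env.setIntegral_index_phi e ω i (hg _).aestronglyMeasurable

theorem integral_walk [MeasurableConstVAdd (Zd d) Ω] {E : Type*} [NormedAddCommGroup E]
    [NormedSpace ℝ E] [CompleteSpace E] {f : Zd d → E} {C : ℝ} (hf : ∀ x, ‖f x‖ ≤ C) (n : ℕ)
    (ω : Ω) (x : Zd d) :
    ∫ s, f (x + env.walk e n (s, x +ᵥ ω)) ∂lebesgueI = (env.stepOp ω)^[n] f x := by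
  induction n generalizing x with
  | zero => simp [walk]
  | succ n ih =>
    have hint (y : Zd d) : Integrable
        (fun s => f (x + (y + env.walk e n (s, y +ᵥ x +ᵥ ω)))) lebesgueI :=
      integrable_comp_of_forall_norm_le (f := fun z => f (x + (y + z))) (fun _ => hf _)
        ((env.measurable_walk e n).comp measurable_prodMk_right)
    simp only [walk_succ, povMap]
    rw [env.integral_displacement_phi e (x +ᵥ ω) hint, Function.iterate_succ_apply', stepOp]
    refine Finset.sum_congr rfl fun y _ => ?_
    rw [env.equivariant, zero_add, add_comm y x, ← ih]
    simp only [vadd_vadd, add_assoc, add_comm y x]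

theorem integral_povMeasure_walk [MeasurableConstVAdd (Zd d) Ω] (P : Measure Ω)
    [IsFiniteMeasure P] {E : Type*} [NormedAddCommGroup E] [NormedSpace ℝ E]
    [CompleteSpace E] {f : Zd d → E} {C : ℝ} (hf : ∀ x, ‖f x‖ ≤ C) (n : ℕ) :
    ∫ x, f (env.walk e n x) ∂(povMeasure P) = ∫ ω, (env.stepOp ω)^[n] f 0 ∂P := by
  rw [povMeasure,
    integral_prod_symm _ (integrable_comp_of_forall_norm_le hf (env.measurable_walk e n))]
  refine integral_congr_ae (.of_forall fun ω => ?_)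
  simpa using env.integral_walk e hf n ω 0

theorem integrable_displacement (P : Measure Ω) [IsFiniteMeasure P] {E : Type*}
    [NormedAddCommGroup E] (f : Zd d → E) :
    Integrable (fun x => f (env.displacement e x)) (povMeasure P) := by
  rw [povMeasure]
  exact .of_bound ((StronglyMeasurable.of_discrete (f := f)).comp_measurable
    (env.measurable_displacement e)).aestronglyMeasurable (∑ y ∈ env.Λ, ‖f y‖)
    (.of_forall fun x => Finset.single_le_sum (f := fun y => ‖f y‖)
      (fun y _ => norm_nonneg _) (e _).2)

theorem integral_displacement (P : Measure Ω) [IsFiniteMeasure P] {E : Type*}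
    [NormedAddCommGroup E] [NormedSpace ℝ E] [CompleteSpace E] (f : Zd d → E) :
    ∫ x, f (env.displacement e x) ∂(povMeasure P)
      = ∑ y ∈ env.Λ, (∫ ω, env.p ω 0 y ∂P) • f y := by
  have hfiber (ω : Ω) : ∫ s, f (env.displacement e (s, ω)) ∂lebesgueI
      = ∑ y ∈ env.Λ, env.p ω 0 y • f y := by
    simpa using env.integral_displacement_phi e ω (g := fun y _ => f y)
      fun y => integrable_const _
  rw [povMeasure, integral_prod_symm _ (env.integrable_displacement e P f)]
  simp_rw [hfiber]
  rw [integral_finsetSum]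
  · exact Finset.sum_congr rfl fun y _ => integral_smul_const _ _
  · exact fun y _ => ((env.memLp_top_transition P y).re.integrable le_top).smul_const _

end PointOfView

section Annealed

variable {E : Type*} [NormedAddCommGroup E] [NormedSpace ℝ E] [CompleteSpace E]

theorem integral_stepKernel (ω : Ω) {f : Zd d → E} {C : ℝ} (hf : ∀ x, ‖f x‖ ≤ C) (x : Zd d) :
    ∫ y, f y ∂(env.stepKernel ω x) = env.stepOp ω f x := by
  change ∫ y, f y ∂(env.stepPMF ω x).toMeasure = _
  rw [PMF.integral_eq_tsum _ f (integrable_comp_of_forall_norm_le hf measurable_id),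
    ← (env.hasSum_stepOp ω f x).tsum_eq]
  refine tsum_congr fun y => congrArg (· • f y) ?_
  exact ENNReal.toReal_ofReal (env.nonneg ω x y)

theorem norm_stepOp_le (ω : Ω) {f : Zd d → E} {C : ℝ} (hf : ∀ x, ‖f x‖ ≤ C) (x : Zd d) :
    ‖env.stepOp ω f x‖ ≤ C := by
  rw [← env.integral_stepKernel ω hf]
  simpa using norm_integral_le_of_norm_le_const (μ := env.stepKernel ω x) (.of_forall hf)

theorem quenched_map_frestrictLe_zero (ω : Ω) :
    (env.quenched ω).map (Preorder.frestrictLe (π := fun _ => Zd d) 0)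
      = Measure.dirac (fun _ => 0) := by
  simp only [quenched, Kernel.trajMeasure]
  rw [Measure.map_comp _ _ (by fun_prop), Kernel.traj_map_frestrictLe, Kernel.partialTraj_self,
    Measure.id_comp, Measure.map_dirac]
  rfl

theorem integral_quenched_zero (ω : Ω) (f : Zd d → E) :
    ∫ ξ, f (ξ 0) ∂(env.quenched ω) = f 0 := by
  have hmap := integral_map (μ := env.quenched ω)
    (φ := Preorder.frestrictLe (π := fun _ => Zd d) 0) (by fun_prop)
    (f := fun η => f (η ⟨0, by simp⟩)) StronglyMeasurable.of_discrete.aestronglyMeasurable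
  rw [quenched_map_frestrictLe_zero, integral_dirac] at hmap
  exact hmap.symm

theorem integral_quenched_succ (ω : Ω) {f : Zd d → E} {C : ℝ} (hf : ∀ x, ‖f x‖ ≤ C) (n : ℕ) :
    ∫ ξ, f (ξ (n + 1)) ∂(env.quenched ω) = ∫ ξ, env.stepOp ω f (ξ n) ∂(env.quenched ω) := by
  have hint {ν : Measure ((Finset.Iic n → Zd d) × Zd d)} [IsFiniteMeasure ν] :
      Integrable (fun η => f η.2) ν :=
    integrable_comp_of_forall_norm_le hf measurable_snd
  calc ∫ ξ, f (ξ (n + 1)) ∂(env.quenched ω)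
      = ∫ η, f η.2 ∂((env.quenched ω).map (fun ξ : ℕ → Zd d =>
          (Preorder.frestrictLe (π := fun _ => Zd d) n ξ, ξ (n + 1)))) :=
        (integral_map (φ := fun ξ : ℕ → Zd d =>
          (Preorder.frestrictLe (π := fun _ => Zd d) n ξ, ξ (n + 1))) (by fun_prop)
          hint.aestronglyMeasurable).symm
    _ = ∫ η, env.stepOp ω f (η ⟨n, by simp⟩) ∂((env.quenched ω).map
          (Preorder.frestrictLe (π := fun _ => Zd d) n)) := by
        rw [quenched, ← Kernel.map_frestrictLe_trajMeasure_compProd_eq_map_trajMeasure,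
          Measure.integral_compProd hint]
        exact integral_congr_ae (.of_forall fun η => env.integral_stepKernel ω hf _)
    _ = ∫ ξ, env.stepOp ω f (ξ n) ∂(env.quenched ω) :=
        integral_map (φ := Preorder.frestrictLe (π := fun _ => Zd d) n)
          (f := fun η => env.stepOp ω f (η ⟨n, by simp⟩)) (by fun_prop)
          StronglyMeasurable.of_discrete.aestronglyMeasurable

theorem integral_quenched (ω : Ω) {f : Zd d → E} {C : ℝ} (hf : ∀ x, ‖f x‖ ≤ C) (n : ℕ) :
    ∫ ξ, f (ξ n) ∂(env.quenched ω) = (env.stepOp ω)^[n] f 0 := by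
  induction n generalizing f with
  | zero => exact env.integral_quenched_zero ω f
  | succ n ih =>
    rw [env.integral_quenched_succ ω hf, ih (env.norm_stepOp_le ω hf),
      Function.iterate_succ_apply]

theorem integral_annealed (P : Measure Ω) [IsFiniteMeasure P] {f : Zd d → E} {C : ℝ}
    (hf : ∀ x, ‖f x‖ ≤ C) (n : ℕ) :
    ∫ ξ, f (ξ.2 n) ∂(env.annealed P) = ∫ ω, (env.stepOp ω)^[n] f 0 ∂P := by
  rw [annealed, Measure.integral_compProd (integrable_comp_of_forall_norm_le hf
    (Y := fun ξ : Ω × (ℕ → Zd d) => ξ.2 n) ((measurable_pi_apply n).comp measurable_snd))]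
  exact integral_congr_ae (.of_forall fun ω => env.integral_quenched ω hf n)

end Annealed

end Environment

/-! ### The central limit theorem -/

theorem inner_toEuclid {d : ℕ} (x : Zd d) (t : EuclideanSpace ℝ (Fin d)) :
    inner ℝ (toEuclid x) t = ∑ α, (x α : ℝ) * t α := by
  simp [toEuclid, PiLp.inner_apply, mul_comm]

theorem satisfiesCLT_of_tendsto_integral_expChar {d : ℕ} {S : Type*} [MeasurableSpace S]
    {X : ℕ → S → Zd d} (hX : ∀ n, Measurable (X n)) (μ : Measure S) [IsProbabilityMeasure μ]
    {C : Matrix (Fin d) (Fin d) ℝ} (hC : C.PosSemidef)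
    (hlim : ∀ t : EuclideanSpace ℝ (Fin d), Tendsto
      (fun n : ℕ => ∫ s, expChar ((√(n : ℝ))⁻¹ • t) (X n s) ∂μ) atTop
      (𝓝 (Complex.exp (-((t.ofLp ⬝ᵥ C.mulVec t.ofLp) / 2 : ℝ))))) :
    SatisfiesCLT X μ C := by
  have hmeas (n : ℕ) : Measurable fun s => (√(n : ℝ))⁻¹ • toEuclid (X n s) :=
    (Measurable.of_discrete (f := fun y : Zd d => (√(n : ℝ))⁻¹ • toEuclid y)).comp (hX n)
  refine ⟨hC, fun n => (hmeas n).aemeasurable, aemeasurable_id,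
    ProbabilityMeasure.tendsto_iff_tendsto_charFun.2 fun t => ?_⟩
  simp only [ProbabilityMeasure.coe_mk, Measure.map_id]
  rw [charFun_multivariateGaussian hC]
  convert hlim t using 2 with n
  · rw [charFun_apply, integral_map (hmeas n).aemeasurable (by fun_prop)]
    simp_rw [expChar_apply, real_inner_smul_left, real_inner_smul_right]
  · simp

namespace Environment

variable {d : ℕ} {Ω : Type*} [MeasurableSpace Ω] [AddAction (Zd d) Ω] (env : Environment d Ω)
  (e : Fin env.Λ.card ≃ env.Λ) (P : Measure Ω)

theorem dotProduct_covMatrix_mulVec [IsFiniteMeasure P] (t : EuclideanSpace ℝ (Fin d)) :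
    t.ofLp ⬝ᵥ (env.covMatrix e P).mulVec t.ofLp
      = ∑ y ∈ env.Λ, (∫ ω, env.p ω 0 y ∂P) * inner ℝ (toEuclid y) t ^ 2 := by
  have hentry (α β : Fin d) : env.covMatrix e P α β
      = ∑ y ∈ env.Λ, (∫ ω, env.p ω 0 y ∂P) * ((y α : ℝ) * (y β : ℝ)) :=
    env.integral_displacement e P fun y => (y α : ℝ) * (y β : ℝ)
  simp only [dotProduct, Matrix.mulVec, hentry, inner_toEuclid, sq, Finset.sum_mul,
    Finset.mul_sum]
  rw [Finset.sum_comm (s := env.Λ)]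
  refine Finset.sum_congr rfl fun α _ => ?_
  rw [Finset.sum_comm (s := env.Λ)]
  refine Finset.sum_congr rfl fun β _ => Finset.sum_congr rfl fun y _ => ?_
  ring

theorem posSemidef_covMatrix [IsFiniteMeasure P] : (env.covMatrix e P).PosSemidef := by
  refine .of_dotProduct_mulVec_nonneg ?_ fun x => ?_
  · ext α β
    simp [covMatrix, mul_comm]
  · rw [star_trivial]
    refine (Finset.sum_nonneg fun y _ => ?_).trans_eq
      (env.dotProduct_covMatrix_mulVec e P (WithLp.toLp 2 x)).symm
    exact mul_nonneg (integral_nonneg fun ω => env.nonneg ω 0 y) (sq_nonneg _)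

theorem satisfiesCLT_of_integral_expChar_eq [MeasurableConstVAdd (Zd d) Ω]
    [IsProbabilityMeasure P] [ErgodicVAdd (Zd d) Ω P] (hirr : env.AlmostSurelyIrreducible P)
    {S : Type*} [MeasurableSpace S] {μ : Measure S} [IsProbabilityMeasure μ] {X : ℕ → S → Zd d}
    (hX : ∀ n, Measurable (X n))
    (hlaw : ∀ n t, ∫ s, expChar t (X n s) ∂μ = ∫ ω, (env.stepOp ω)^[n] (expChar t) 0 ∂P) :
    SatisfiesCLT X μ (env.covMatrix e P) := by
  refine satisfiesCLT_of_tendsto_integral_expChar hX μ (env.posSemidef_covMatrix e P) fun t => ?_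
  simp only [hlaw, env.dotProduct_covMatrix_mulVec e P]
  exact env.tendsto_integral_iterate_stepOp_expChar P hirr t

end Environment

end BistochasticRWRE

theorem mainTheorem1 {d : ℕ} {Ω : Type*} [MeasurableSpace Ω] [AddAction (Zd d) Ω]
    [MeasurableConstVAdd (Zd d) Ω] (P : Measure Ω) [IsProbabilityMeasure P]
    [ErgodicVAdd (Zd d) Ω P] (env : Environment d Ω) (hirr : env.AlmostSurelyIrreducible P)
    (e : Fin env.Λ.card ≃ env.Λ) :
    (∀ α β, Integrable
      (fun x => (env.displacement e x α : ℝ) * (env.displacement e x β : ℝ)) (povMeasure P)) ∧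
    SatisfiesCLT (env.walk e) (povMeasure P) (env.covMatrix e P) ∧
    SatisfiesCLT (fun n (ξ : Ω × (ℕ → Zd d)) => ξ.2 n) (env.annealed P) (env.covMatrix e P) := by
  refine ⟨fun α β => env.integrable_displacement e P fun y => (y α : ℝ) * (y β : ℝ),
    env.satisfiesCLT_of_integral_expChar_eq e P hirr (env.measurable_walk e) fun n t => ?_,
    env.satisfiesCLT_of_integral_expChar_eq e P hirr
      (fun n => (measurable_pi_apply n).comp measurable_snd) fun n t => ?_⟩
  · exact env.integral_povMeasure_walk e P (fun y => (norm_expChar t y).le) n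
  · exact env.integral_annealed P (fun y => (norm_expChar t y).le) n
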